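/- For an integer $r\ge 2$, an $r$-uniform graph ($r$-graph) $G$ consists of a finite vertex set $V(G)$ and a set $E(G)$ of $r$-element subsets of $V(G)$; its density is $d(G)=|E(G)|/\binom{|V(G)|}{r}$. A number $\alpha\in[0,1)$ is a jump for $r$ if there is a constant $c>0$ such that for every $\epsilon>0$ and every integer $m\ge r$ there is an integer $n_0(\epsilon,m)$ such that every $r$-graph with $n>n_0(\epsilon,m)$ vertices and density at least $\alpha+\epsilon$ contains a (not necessarily induced) subgraph with $m$ vertices and density at least $\alpha+c$. For a (possibly infinite) family $\mathcal F$ of $r$-graphs, $\mathrm{ex}(n,\mathcal F)$ is the maximum number of edges of an $r$-graph on $n$ vertices that contains no isomorphic copy of a member of $\mathcal F$, and the Turán density of $\mathcal F$ is $\pi(\mathcal F)=\lim_{n\to\infty}\mathrm{ex}(n,\mathcal F)/\binom{n}{r}$. **Theorem.** The number $\frac{12}{25}$ is not a jump for $r=3$. Moreover, for every $c>0$ there is a family $\mathcal F$ of $3$-graphs with $\frac{12}{25}<\pi(\mathcal F)<\frac{12}{25}+c$. -/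

import Mathlib

/-- An `r`-uniform graph on the vertex set `V`: a finite set of edges, each an `r`-element
subset of `V`. -/
structure UniformGraph (r : ℕ) (V : Type*) where
  edges : Finset (Finset V)
  uniform : ∀ e ∈ edges, e.card = r

namespace UniformGraph

/-- The density `|E(G)| / (|V(G)| choose r)` of an `r`-graph on a finite vertex set. -/
noncomputable def density {r : ℕ} {V : Type*} [Fintype V] (G : UniformGraph r V) : ℝ :=
  (G.edges.card : ℝ) / ((Fintype.card V).choose r : ℝ)

/-- `G` contains an isomorphic copy of `H` (as a not necessarily induced subgraph): there is
an injection of the vertices of `H` into those of `G` that sends edges to edges. -/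
def ContainsCopy {r : ℕ} {V W : Type*} (G : UniformGraph r V) (H : UniformGraph r W) : Prop :=
  ∃ f : W ↪ V, ∀ e ∈ H.edges, e.map f ∈ G.edges

end UniformGraph

/-- A family of finite `r`-graphs, each taken (up to isomorphism) on a vertex set `Fin k`.
The family may be infinite. -/
abbrev UniformFamily (r : ℕ) : Type := Set (Σ k : ℕ, UniformGraph r (Fin k))

/-- `G` is `F`-free: it contains no isomorphic copy of a member of `F`. -/
def UniformGraph.IsFree {r : ℕ} {V : Type*} (G : UniformGraph r V) (F : UniformFamily r) : Prop :=
  ∀ H ∈ F, ¬ G.ContainsCopy H.2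

/-- The Turán number `ex(n, F)`: the maximum number of edges of an `F`-free `r`-graph on `n`
vertices. (The set below is finite; if there is no `F`-free `r`-graph on `n` vertices, the value
is `0`.) -/
noncomputable def turanNumber {r : ℕ} (n : ℕ) (F : UniformFamily r) : ℕ :=
  sSup {k : ℕ | ∃ G : UniformGraph r (Fin n), G.IsFree F ∧ G.edges.card = k}

/-- `π(F) = d`, that is, `ex(n, F) / (n choose r)` tends to `d` as `n → ∞`. -/
def HasTuranDensity {r : ℕ} (F : UniformFamily r) (d : ℝ) : Prop :=
  Filter.Tendsto (fun n : ℕ => (turanNumber n F : ℝ) / (n.choose r : ℝ)) Filter.atTop (nhds d)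

/-- The set of all Turán densities of (finite or infinite) families of `r`-graphs. -/
def turanDensities (r : ℕ) : Set ℝ :=
  {d | ∃ F : UniformFamily r, HasTuranDensity F d}

/-- `α` is a jump for `r` (used for `α ∈ [0, 1)` and `r ≥ 2`): there is `c > 0` such that for
every `ε > 0` and every `m ≥ r`, every `r`-graph on sufficiently many vertices with density at
least `α + ε` contains a subgraph on `m` vertices with density at least `α + c`. -/
def IsJump (r : ℕ) (α : ℝ) : Prop :=
  ∃ c : ℝ, 0 < c ∧ ∀ ε : ℝ, 0 < ε → ∀ m : ℕ, r ≤ m → ∃ n₀ : ℕ, ∀ n : ℕ, n₀ < n →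
    ∀ G : UniformGraph r (Fin n), α + ε ≤ G.density →
      ∃ H : UniformGraph r (Fin m), G.ContainsCopy H ∧ α + c ≤ H.density

/-! Take three parts A, B, C with edges of types ABC, AAB, BBC. The relative sizes 2/5, 2/5, 1/5 are
optimal and give limiting density 12/25. With 2q, 2q, q labels, the pairs in AAB and BBC need
distinct labels, which costs 3q² edges; a 3-graph M inside A with at least 4q² edges more than
repays this, so every balanced blow-up has density at least 12/25 + 6/(125q).

Locally M must be invisible: any s vertices, 2 ≤ s ≤ m, span at most s - 2 of its edges
(`exists_locally_sparse`). In an m-vertex subgraph with a_i vertices at the i-th label of A and a,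
b, c vertices in the parts, M then contributes at most the missing diagonal term (b/2) ∑ a_i² plus
max(0, a - b)³/27 (`sparse_edge_polynomial_le_sum_sq`). Since a = b at the optimum, the deficit of
the pattern polynomial absorbs this cubic error (`pattern_polynomial_le`), leaving at most 2m³/25
edges.

This refutes the jump. Forbidding all m-vertex 3-graphs of density at least 12/25 + c/2 gives the
family. -/

/-! ### Locally sparse 3-graphs by the deletion method. -/

open Finset in
/-- In the binomial random subset of `T` with parameter `p`, a fixed set `F ⊆ T` is contained
with probability `p ^ #F`. -/
theorem sum_powerset_binomial_superset {α : Type*} [DecidableEq α] (T F : Finset α) (hF : F ⊆ T)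
    (p : ℝ) :
    ∑ H ∈ T.powerset, (p ^ #H * (1 - p) ^ #(T \ H)) * (if F ⊆ H then 1 else 0) = p ^ #F := by
  -- In the expansion, `H` collects the elements contributing `p`; the factor 0 on `F` kills every
  -- `H` not containing `F`.
  have h := Finset.prod_add (fun _ : α => p) (fun e => if e ∈ F then 0 else 1 - p) T
  have h1 : ∏ e ∈ T, (p + if e ∈ F then 0 else 1 - p) = p ^ #F := by
    have : ∀ e ∈ T, (p + if e ∈ F then 0 else 1 - p) = if e ∈ F then p else 1 := by
      intro e _
      split_ifs <;> ring
    rw [prod_congr rfl this, prod_ite, prod_const, prod_const_one, mul_one,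
      filter_mem_eq_inter, inter_eq_right.2 hF]
  rw [← h1, h]
  refine sum_congr rfl fun H hH => ?_
  rw [prod_const]
  split_ifs with hFH
  · rw [mul_one, prod_congr rfl (g := fun _ => 1 - p), prod_const]
    intro e he
    rw [if_neg]
    exact fun h' => (mem_sdiff.1 he).2 (hFH h')
  · obtain ⟨e, heF, heH⟩ := not_subset.1 hFH
    have h0 : ∏ e ∈ T \ H, (if e ∈ F then 0 else 1 - p) = 0 :=
      prod_eq_zero (mem_sdiff.2 ⟨hF heF, heH⟩) (by rw [if_pos heF])
    rw [h0, mul_zero, mul_zero]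

open Finset in
/-- First moment method: if the expected number of members of `B` contained in a binomial random
subset of `T` is less than its expected size by at least `c`, then some subset of `T` has size at
least `c` plus the number of members of `B` that it contains. -/
theorem exists_subset_card_sub_count_ge {α : Type*} [DecidableEq α] (T : Finset α) {ι : Type*}
    (B : Finset ι) (F : ι → Finset α) (hF : ∀ i ∈ B, F i ⊆ T) (p c : ℝ) (hp0 : 0 ≤ p)
    (hp1 : p ≤ 1) (hc : c + ∑ i ∈ B, p ^ #(F i) ≤ p * #T) :
    ∃ H ⊆ T, c + #{i ∈ B | F i ⊆ H} ≤ (#H : ℝ) := by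
  by_contra! hcon
  set w : Finset α → ℝ := fun H => p ^ #H * (1 - p) ^ #(T \ H) with hw
  have hw0 : ∀ H, 0 ≤ w H := fun H => mul_nonneg (pow_nonneg hp0 _) (pow_nonneg (by linarith) _)
  have hw1 : ∑ H ∈ T.powerset, w H = 1 := by
    simpa using sum_powerset_binomial_superset T ∅ (empty_subset _) p
  have hE : ∑ H ∈ T.powerset, w H * #H = p * #T := by
    have : ∀ H ∈ T.powerset, w H * #H = ∑ e ∈ T, w H * (if {e} ⊆ H then 1 else 0) := by
      intro H hH
      rw [← mul_sum]
      congr 1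
      simp only [singleton_subset_iff]
      rw [sum_boole, filter_mem_eq_inter, inter_eq_right.2 (mem_powerset.1 hH)]
    rw [sum_congr rfl this, sum_comm]
    have : ∀ e ∈ T, ∑ H ∈ T.powerset, w H * (if {e} ⊆ H then 1 else 0) = p := by
      intro e he
      rw [sum_powerset_binomial_superset T {e} (singleton_subset_iff.2 he) p]
      simp
    rw [sum_congr rfl this, sum_const, nsmul_eq_mul, mul_comm]
  have hB : ∑ H ∈ T.powerset, w H * #{i ∈ B | F i ⊆ H} = ∑ i ∈ B, p ^ #(F i) := by
    have : ∀ H ∈ T.powerset, w H * #{i ∈ B | F i ⊆ H} =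
        ∑ i ∈ B, w H * (if F i ⊆ H then 1 else 0) := by
      intro H _
      rw [← mul_sum, sum_boole]
    rw [sum_congr rfl this, sum_comm]
    exact sum_congr rfl fun i hi => sum_powerset_binomial_superset T (F i) (hF i hi) p
  have hle : ∑ H ∈ T.powerset, w H * #H < ∑ H ∈ T.powerset, w H * (c + #{i ∈ B | F i ⊆ H}) := by
    have hex : ∃ H ∈ T.powerset, 0 < w H := by
      by_contra! h
      have := sum_nonpos h
      linarith
    obtain ⟨H, hH, hH0⟩ := hex
    exact sum_lt_sum
      (fun H hH => mul_le_mul_of_nonneg_left (hcon H (mem_powerset.1 hH)).le (hw0 H))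
      ⟨H, hH, mul_lt_mul_of_pos_left (hcon H (mem_powerset.1 hH)) hH0⟩
  simp only [mul_add, sum_add_distrib, ← sum_mul] at hle
  rw [hE, hB, hw1] at hle
  linarith

open Finset in
/-- For every `m` and every large enough `t` there is a 3-graph on `t` vertices with at least
`t ^ 2` edges in which any `s` vertices, `2 ≤ s ≤ m`, span at most `s - 2` edges. -/
theorem exists_locally_sparse (m : ℕ) : ∃ t₀ : ℕ, ∀ t ≥ t₀, ∃ M : Finset (Finset (Fin t)),
    (∀ e ∈ M, #e = 3) ∧ t ^ 2 ≤ #M ∧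
      ∀ S : Finset (Fin t), 2 ≤ #S → #S ≤ m → #{e ∈ M | e ⊆ S} + 2 ≤ #S := by
  set A : ℝ := ∑ s ∈ Icc 2 m, (((s.choose 3).choose (s - 1) : ℕ) : ℝ) * 12 ^ (s - 1) with hA
  obtain ⟨t₀, ht₀⟩ := exists_nat_ge (A + 12)
  refine ⟨t₀, fun t ht => ?_⟩
  have hA0 : 0 ≤ A := sum_nonneg fun s _ => by positivity
  have htA : A + 12 ≤ t := ht₀.trans (by exact_mod_cast ht)
  have ht0 : (0 : ℝ) < t := by linarith
  set T : Finset (Finset (Fin t)) := powersetCard 3 univ with hT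
  set I : Finset (Finset (Fin t)) := {S | 2 ≤ #S ∧ #S ≤ m} with hI
  -- A bad pair is a set `S` with `#S - 1` triples inside it. There are O(t^s) sets of size s, each
  -- weighted by (12/t)^(s-1), so the expected number of bad pairs is at most `A * t`.
  set B : Finset (Σ _ : Finset (Fin t), Finset (Finset (Fin t))) :=
    I.sigma fun S => powersetCard (#S - 1) (powersetCard 3 S) with hB
  have hTcard : (#T : ℝ) = t * (t - 1) * (t - 2) / 6 := by
    rw [hT, card_powersetCard, card_univ, Fintype.card_fin, Nat.cast_choose_eq_descPochhammer_div]
    simp [descPochhammer_succ_right, Nat.factorial]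
  have hbad : ∑ i ∈ B, ((12 : ℝ) / t) ^ #i.2 ≤ A * t := by
    rw [hB, sum_sigma]
    have h1 : ∀ S ∈ I, ∑ F ∈ powersetCard (#S - 1) (powersetCard 3 S), ((12 : ℝ) / t) ^ #F =
        (((#S).choose 3).choose (#S - 1) : ℕ) * (12 / t) ^ (#S - 1) := by
      intro S _
      rw [sum_congr rfl (g := fun _ => ((12 : ℝ) / t) ^ (#S - 1)), sum_const, card_powersetCard,
        card_powersetCard, nsmul_eq_mul]
      intro F hF
      rw [(mem_powersetCard.1 hF).2]
    rw [sum_congr rfl h1]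
    have hmaps : ∀ S ∈ I, #S ∈ Icc 2 m := by
      intro S hS
      simpa [hI] using hS
    rw [← sum_fiberwise_of_maps_to hmaps, hA, sum_mul]
    refine sum_le_sum fun s hs => ?_
    rw [sum_congr rfl (g := fun _ => (((s.choose 3).choose (s - 1) : ℕ) : ℝ) * (12 / t) ^ (s - 1)),
      sum_const, nsmul_eq_mul]
    · have hc : #{S ∈ I | #S = s} ≤ t ^ s := by
        calc #{S ∈ I | #S = s} ≤ #(powersetCard s (univ : Finset (Fin t))) := by
              refine card_le_card fun S hS => ?_
              simp [mem_powersetCard, (mem_filter.1 hS).2]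
          _ ≤ t ^ s := by
              rw [card_powersetCard, card_univ, Fintype.card_fin]
              exact Nat.choose_le_pow _ _
      have hs2 : s = (s - 1) + 1 := by have := (mem_Icc.1 hs).1; omega
      have hts : (t : ℝ) ^ s = t ^ (s - 1) * t := by rw [← pow_succ, ← hs2]
      calc (#{S ∈ I | #S = s} : ℝ) * ((((s.choose 3).choose (s - 1) : ℕ) : ℝ) * (12 / t) ^ (s - 1))
          ≤ (t : ℝ) ^ s * ((((s.choose 3).choose (s - 1) : ℕ) : ℝ) * (12 / t) ^ (s - 1)) := by
            gcongr
            exact_mod_cast hc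
        _ = _ := by
            rw [hts, div_pow]
            field_simp
    · intro S hS
      rw [(mem_filter.1 hS).2]
  obtain ⟨H, hHT, hH⟩ := exists_subset_card_sub_count_ge T B (fun i => i.2)
    (by
      rintro ⟨S, F⟩ hi
      have := (mem_powersetCard.1 (mem_sigma.1 hi).2).1
      exact this.trans (powersetCard_mono (subset_univ S)))
    -- The expected number of edges is 2(t-1)(t-2), which exceeds t² + At once t ≥ A + 12.
    (12 / t) ((t : ℝ) ^ 2) (by positivity) (by rw [div_le_one ht0]; linarith) (by
      have : (12 : ℝ) / t * #T = 2 * (t - 1) * (t - 2) := by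
        rw [hTcard]; field_simp; ring
      rw [this]
      nlinarith)
  -- delete one edge from each bad configuration
  have hne : ∀ i ∈ B, i.2.Nonempty := by
    rintro ⟨S, F⟩ hi
    obtain ⟨h1, h2⟩ := mem_sigma.1 hi
    have h2 := (mem_powersetCard.1 h2).2
    have h1 : 2 ≤ #S ∧ #S ≤ m := by simpa [hI] using h1
    rw [← card_pos]
    change 0 < #F
    dsimp only at h2
    omega
  choose! g hg using hne
  set D := {i ∈ B | i.2 ⊆ H}.image g with hD
  refine ⟨H \ D, fun e he => (mem_powersetCard.1 (hHT (mem_sdiff.1 he).1)).2, ?_, ?_⟩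
  · have h1 : #D ≤ #{i ∈ B | i.2 ⊆ H} := card_image_le
    have h2 : #H - #D ≤ #(H \ D) := le_card_sdiff _ _
    have h3 : t ^ 2 + #{i ∈ B | i.2 ⊆ H} ≤ #H := by exact_mod_cast hH
    omega
  · intro S hS2 hSm
    by_contra! hcon
    obtain ⟨F, hFsub, hFcard⟩ := exists_subset_card_eq
      (show #S - 1 ≤ #{e ∈ H \ D | e ⊆ S} by omega)
    have hi : (⟨S, F⟩ : Σ _ : Finset (Fin t), Finset (Finset (Fin t))) ∈ B := by
      rw [hB, mem_sigma]
      refine ⟨by simp [hI, hS2, hSm], mem_powersetCard.2 ⟨fun e he => ?_, hFcard⟩⟩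
      have := mem_filter.1 (hFsub he)
      exact mem_powersetCard.2
        ⟨this.2, (mem_powersetCard.1 (hHT (mem_sdiff.1 this.1).1)).2⟩
    have hFH : F ⊆ H := fun e he => (mem_sdiff.1 (mem_filter.1 (hFsub he)).1).1
    have h1 := hg _ hi
    have h2 := (mem_sdiff.1 (mem_filter.1 (hFsub h1)).1).2
    exact h2 (mem_image_of_mem g (mem_filter.2 ⟨hi, hFH⟩))

/-! ### The edge polynomial of a locally sparse 3-graph. -/

open Finset in
/-- If every subset `S` of `U` with at least two elements contains at most `#S - 2` members of the
3-graph `M`, then its edge polynomial is bounded by the product of the two largest weights and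
the sum of all the others. -/
theorem sparse_edge_polynomial_le {ι : Type*} [DecidableEq ι] (M : Finset (Finset ι))
    (hM3 : ∀ e ∈ M, #e = 3) (U : Finset ι) (hMU : ∀ e ∈ M, e ⊆ U)
    (hM : ∀ S ⊆ U, 2 ≤ #S → #{e ∈ M | e ⊆ S} + 2 ≤ #S) (a : ι → ℝ) (ha : ∀ i, 0 ≤ a i)
    {u v : ι} (hu : u ∈ U) (hv : v ∈ U) (huv : u ≠ v) (hmaxu : ∀ i ∈ U, a i ≤ a u)
    (hmaxv : ∀ i ∈ U, i ≠ u → a i ≤ a v) :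
    ∑ e ∈ M, ∏ i ∈ e, a i ≤ a u * a v * (∑ i ∈ U, a i - a u - a v) := by
  have : Nonempty ι := ⟨u⟩
  -- Let `x e` be the lightest vertex of `e`; the other two have weight product at most `a u * a v`.
  have hmin : ∀ e ∈ M, ∃ x ∈ e, ∀ y ∈ e, a x ≤ a y := fun e he =>
    exists_min_image e a (card_pos.1 (by rw [hM3 e he]; norm_num))
  choose! x hxe hx using hmin
  have hprod : ∀ e ∈ M, ∏ i ∈ e, a i ≤ a u * a v * a (x e) := by
    intro e he
    have hcard : #(e.erase (x e)) = 2 := by rw [card_erase_of_mem (hxe e he), hM3 e he]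
    obtain ⟨y, z, hyz, h2⟩ := card_eq_two.1 hcard
    have hsub : ∀ w ∈ ({y, z} : Finset ι), w ∈ U := fun w hw =>
      hMU e he (mem_of_mem_erase (h2 ▸ hw))
    have hy := hsub y (by simp)
    have hz := hsub z (by simp)
    rw [← prod_erase_mul _ _ (hxe e he), h2, prod_pair hyz]
    refine mul_le_mul_of_nonneg_right ?_ (ha _)
    by_cases hyu : y = u
    · exact mul_le_mul (hmaxu y hy) (hmaxv z hz (fun h => hyz (hyu.trans h.symm))) (ha _) (ha _)
    · rw [mul_comm (a u)]
      exact mul_le_mul (hmaxv y hy hyu) (hmaxu z hz) (ha _) (ha _)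
  have hW : ∑ i ∈ U, a i - a u - a v = ∑ i ∈ (U.erase u).erase v, a i := by
    rw [sum_erase_eq_sub (mem_erase.2 ⟨huv.symm, hv⟩), sum_erase_eq_sub hu]
  -- Hall's theorem matches each edge to a vertex at least as heavy as its lightest vertex
  have hHall : ∃ f : {e // e ∈ M} → ι, Function.Injective f ∧
      ∀ e : {e // e ∈ M}, f e ∈ {i ∈ (U.erase u).erase v | a (x e) ≤ a i} := by
    refine (all_card_le_biUnion_card_iff_exists_injective
      (fun e : {e // e ∈ M} => {i ∈ (U.erase u).erase v | a (x e) ≤ a i})).1 fun s => ?_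
    rcases s.eq_empty_or_nonempty with rfl | hs
    · simp
    obtain ⟨e₀, he₀, hmin⟩ := exists_min_image s (fun e => a (x e)) hs
    -- All edges of `s` lie in this superlevel set, so there are at most `#X - 2` of them, and
    -- removing `u` and `v` from `X` still leaves enough partners for Hall's condition.
    set X := {i ∈ U | a (x e₀) ≤ a i} with hX
    have hsX : ∀ e ∈ s, e.1 ⊆ X := fun e he i hi =>
      mem_filter.2 ⟨hMU e e.2 hi, (hmin e he).trans (hx e e.2 i hi)⟩
    have hX2 : 2 ≤ #X := by
      have := card_le_card (hsX e₀ he₀)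
      rw [hM3 _ e₀.2] at this
      omega
    have h1 : #s ≤ #{e ∈ M | e ⊆ X} := by
      rw [← card_map (Function.Embedding.subtype _)]
      refine card_le_card fun e he => ?_
      obtain ⟨e', he', rfl⟩ := mem_map.1 he
      exact mem_filter.2 ⟨e'.2, hsX e' he'⟩
    have h2 := hM X (filter_subset _ _) hX2
    have h3 : #X ≤ #((X.erase u).erase v) + 2 := by
      have := pred_card_le_card_erase (s := X) (a := u)
      have := pred_card_le_card_erase (s := X.erase u) (a := v)
      omega
    have h4 : (X.erase u).erase v ⊆ {i ∈ (U.erase u).erase v | a (x e₀) ≤ a i} := by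
      intro i hi
      simp only [hX, mem_erase, mem_filter] at hi ⊢
      tauto
    have h5 := card_le_card (h4.trans (subset_biUnion_of_mem
      (fun e : {e // e ∈ M} => {i ∈ (U.erase u).erase v | a (x e) ≤ a i}) he₀))
    omega
  obtain ⟨f, hf, hfm⟩ := hHall
  calc ∑ e ∈ M, ∏ i ∈ e, a i ≤ ∑ e ∈ M, a u * a v * a (x e) := sum_le_sum hprod
    _ = a u * a v * ∑ e : {e // e ∈ M}, a (x e) := by
        rw [← mul_sum, ← sum_coe_sort M (fun e => a (x e))]
    _ ≤ a u * a v * ∑ i ∈ (U.erase u).erase v, a i := by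
        refine mul_le_mul_of_nonneg_left ?_ (mul_nonneg (ha _) (ha _))
        calc ∑ e : {e // e ∈ M}, a (x e) ≤ ∑ e : {e // e ∈ M}, a (f e) :=
              sum_le_sum fun e _ => (mem_filter.1 (hfm e)).2
          _ = ∑ i ∈ univ.map ⟨f, hf⟩, a i := by simp
          _ ≤ _ := by
              refine sum_le_sum_of_subset_of_nonneg (fun i hi => ?_) fun i _ _ => ha i
              obtain ⟨e, _, rfl⟩ := mem_map.1 hi
              exact (mem_filter.1 (hfm e)).1
    _ = _ := by rw [hW]

/-- The AM-GM inequality for three numbers, with the last allowed to be negative. -/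
theorem mul_mul_le_max_cube {u v w : ℝ} (hu : 0 ≤ u) (hv : 0 ≤ v) :
    u * v * w ≤ max 0 (u + v + w) ^ 3 / 27 := by
  rcases le_or_gt w 0 with hw | hw
  · have : u * v * w ≤ 0 := mul_nonpos_of_nonneg_of_nonpos (mul_nonneg hu hv) hw
    have : 0 ≤ max 0 (u + v + w) ^ 3 := pow_nonneg (le_max_left _ _) 3
    linarith
  · rw [max_eq_right (by positivity)]
    nlinarith [mul_nonneg hu (sq_nonneg (v - w)), mul_nonneg hv (sq_nonneg (u - w)),
      mul_nonneg hw.le (sq_nonneg (u - v)), mul_nonneg hu (sq_nonneg (u - v)),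
      mul_nonneg hu (sq_nonneg (u - w)), mul_nonneg hv (sq_nonneg (v - u)),
      mul_nonneg hv (sq_nonneg (v - w)), mul_nonneg hw.le (sq_nonneg (w - u)),
      mul_nonneg hw.le (sq_nonneg (w - v))]

open Finset in
/-- The edge polynomial of a locally sparse 3-graph is controlled by the sum of the squares of the
weights, up to a cubic term. -/
theorem sparse_edge_polynomial_le_sum_sq {ι : Type*} [Fintype ι] [DecidableEq ι]
    (M : Finset (Finset ι)) (hM3 : ∀ e ∈ M, #e = 3) (m : ℕ)
    (hM : ∀ S : Finset ι, 2 ≤ #S → #S ≤ m → #{e ∈ M | e ⊆ S} + 2 ≤ #S)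
    (a : ι → ℝ) (ha : ∀ i, 0 ≤ a i) (hsupp : #{i | a i ≠ 0} ≤ m) {b : ℝ} (hb : 0 ≤ b) :
    ∑ e ∈ M, ∏ i ∈ e, a i ≤ b / 2 * ∑ i, a i ^ 2 + max 0 (∑ i, a i - b) ^ 3 / 27 := by
  set U : Finset ι := {i | a i ≠ 0} with hU
  have hrestrict : ∑ e ∈ M, ∏ i ∈ e, a i = ∑ e ∈ M with e ⊆ U, ∏ i ∈ e, a i := by
    refine (sum_filter_of_ne fun e _ hne i hi => ?_).symm
    simpa [hU] using prod_ne_zero_iff.1 hne i hi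
  have hsq : 0 ≤ b / 2 * ∑ i, a i ^ 2 :=
    mul_nonneg (by linarith) (sum_nonneg fun i _ => sq_nonneg _)
  have hcube : 0 ≤ max 0 (∑ i, a i - b) ^ 3 := pow_nonneg (le_max_left _ _) 3
  rw [hrestrict]
  rcases lt_or_ge #U 2 with hlt | hge
  · rw [sum_filter, sum_eq_zero]
    · linarith
    · intro e he
      rw [if_neg]
      intro h
      have := card_le_card h
      rw [hM3 e he] at this
      omega
  obtain ⟨u, hu, hmaxu⟩ := exists_max_image U a (card_pos.1 (by omega))
  obtain ⟨v, hv, hmaxv⟩ := exists_max_image (U.erase u) a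
    (card_pos.1 (by rw [card_erase_of_mem hu]; omega))
  obtain ⟨hvu, hvU⟩ := mem_erase.1 hv
  have key := sparse_edge_polynomial_le {e ∈ M | e ⊆ U} (fun e he => hM3 e (mem_filter.1 he).1) U
    (fun e he => (mem_filter.1 he).2)
    (fun S hS h2 => by
      refine le_trans ?_ (hM S h2 ((card_le_card hS).trans hsupp))
      gcongr
      exact filter_subset _ _)
    a ha hu hvU hvu.symm hmaxu (fun i hi hiu => hmaxv i (mem_erase.2 ⟨hiu, hi⟩))
  have hsumU : ∑ i ∈ U, a i = ∑ i, a i := by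
    rw [hU]
    exact sum_filter_ne_zero _
  have hsq2 : a u ^ 2 + a v ^ 2 ≤ ∑ i, a i ^ 2 := by
    rw [← sum_pair (f := fun i => a i ^ 2) hvu.symm]
    exact sum_le_sum_of_subset_of_nonneg (subset_univ _) fun i _ _ => sq_nonneg _
  have h2 : b * (a u * a v) ≤ b / 2 * ∑ i, a i ^ 2 := by
    nlinarith [sq_nonneg (a u - a v)]
  -- Shifting the third factor by `b` splits off `b * a u * a v`, which `h2` pays for with squares;
  -- the three factors left sum to `∑ a i - b`.
  have h3 := mul_mul_le_max_cube (w := ∑ i, a i - a u - a v - b) (ha u) (ha v)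
  have h4 : a u + a v + (∑ i, a i - a u - a v - b) = ∑ i, a i - b := by ring
  rw [h4] at h3
  rw [hsumU] at key
  nlinarith

/-! ### Optimising the part sizes. -/

/-- The Lagrangian polynomial of the pattern `{123, 112, 223}` is at most `2 / 25` on the standard
simplex, with room for the cubic error term caused by the sparse edges. -/
theorem pattern_polynomial_le {a b c : ℝ} (ha : 0 ≤ a) (hb : 0 ≤ b) (hc : 0 ≤ c) :
    b * a ^ 2 / 2 + a * b * c + b ^ 2 * c / 2 + max 0 (a - b) ^ 3 / 27 ≤
      2 / 25 * (a + b + c) ^ 3 := by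
  obtain ⟨s, hs⟩ : ∃ s, s = a + b + c := ⟨_, rfl⟩
  obtain rfl : a = s - b - c := by linarith
  -- Both `d` and `y` vanish exactly at the optimum (2/5, 2/5, 1/5) of the simplex, and `hid` writes
  -- the deficit in their squares.
  obtain ⟨d, hd⟩ : ∃ d, d = 2 * s - 5 * b := ⟨_, rfl⟩
  obtain ⟨y, hy⟩ : ∃ y, y = b - 2 * c := ⟨_, rfl⟩
  have hs0 : 0 ≤ s := by linarith
  have hid : 2 / 25 * s ^ 3 - (b * (s - b - c) ^ 2 / 2 + (s - b - c) * b * c + b ^ 2 * c / 2) =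
      d ^ 2 * (4 * s - 5 * b) / 200 + b * y ^ 2 / 8 := by
    rw [hd, hy]; ring
  have hsum : s - b - c + b + c = s := by ring
  rw [hsum]
  rcases le_or_gt (s - b - c) b with hab | hab
  · rw [max_eq_left (by linarith)]
    rcases le_or_gt (5 * b) (4 * s) with h | h
    · have : 0 ≤ d ^ 2 * (4 * s - 5 * b) := mul_nonneg (sq_nonneg _) (by linarith)
      have : 0 ≤ b * y ^ 2 := mul_nonneg hb (sq_nonneg _)
      linarith
    -- Here the first term of `hid` is negative, but `b` exceeds 4s/5, so the crude bound b(s-b)s/2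
    -- suffices.
    · have h1 : b * (s - b - c) ^ 2 / 2 + (s - b - c) * b * c + b ^ 2 * c / 2 ≤
          b * (s - b) * s / 2 := by
        nlinarith [mul_nonneg hb (mul_nonneg hb ha), mul_nonneg hb (mul_nonneg hc hc)]
      have h2 : b * (s - b) ≤ 4 / 25 * s ^ 2 := by nlinarith
      nlinarith
  · rw [max_eq_right (by linarith)]
    -- here `a - b = (d + y) / 2`
    have hdy : s - b - c - b = (d + y) / 2 := by rw [hd, hy]; ring
    have hdy0 : 0 < d + y := by linarith
    have hyb : y ≤ b := by linarith
    have hsd : 4 * s - 5 * b = 2 * s + d := by rw [hd]; ring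
    have hd2 : d ≤ 2 * s := by linarith
    have hb2 : 2 * b ≤ s := by linarith
    rw [hdy]
    have hgoal : (d + y) ^ 3 / 216 ≤ d ^ 2 * (2 * s + d) / 200 + b * y ^ 2 / 8 := by
      rcases le_or_gt d 0 with hd0 | hd0
      · have hy0 : 0 ≤ y := by linarith
        have h1 : (d + y) ^ 3 ≤ y ^ 3 := pow_le_pow_left₀ hdy0.le (by linarith) 3
        have h2 : y ^ 3 ≤ b * y ^ 2 := by nlinarith [sq_nonneg y]
        have h3 : 0 ≤ d ^ 2 * (2 * s + d) := mul_nonneg (sq_nonneg _) (by linarith)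
        have h4 : 0 ≤ b * y ^ 2 := mul_nonneg hb (sq_nonneg _)
        linarith
      · rcases le_or_gt y 0 with hy0 | hy0
        · have h1 : (d + y) ^ 3 ≤ d ^ 3 := pow_le_pow_left₀ hdy0.le (by linarith) 3
          have h2 : 0 ≤ d ^ 2 * (2 * s) := by positivity
          have h3 : 0 ≤ d ^ 3 := by positivity
          have h4 : 0 ≤ b * y ^ 2 := mul_nonneg hb (sq_nonneg _)
          nlinarith
        -- The weights are tight at d = 4y and fit the available coefficients: 25/(16·216) < 1/100
        -- and 25/216 < 1/8.
        · have h1 : (d + y) ^ 3 ≤ 25 / 16 * d ^ 3 + 25 * y ^ 3 := by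
            nlinarith [mul_nonneg (add_nonneg (mul_nonneg (by norm_num : (0:ℝ) ≤ 3) hd0.le)
              (mul_nonneg (by norm_num : (0:ℝ) ≤ 8) hy0.le)) (sq_nonneg (d - 4 * y))]
          have h2 : y ^ 3 ≤ b * y ^ 2 := by nlinarith [sq_nonneg y]
          have h3 : d ^ 3 ≤ d ^ 2 * (2 * s) := by nlinarith [sq_nonneg d]
          have h4 : 0 ≤ d ^ 3 := by positivity
          nlinarith
    rw [hsd] at hid
    have : ((d + y) / 2) ^ 3 / 27 = (d + y) ^ 3 / 216 := by ring
    linarith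

/-! ### Blow-ups and their edge counts. -/

open Finset in
/-- The sets of `#d` vertices that `g` maps bijectively onto `d` are the transversals of the
fibres of `g` over `d`. -/
theorem card_filter_image_eq {V L : Type*} [Fintype V] [DecidableEq V] [DecidableEq L]
    (g : V → L) (d : Finset L) :
    #{e ∈ powersetCard #d (univ : Finset V) | e.image g = d} = ∏ l ∈ d, #{x | g x = l} := by
  rw [← card_pi]
  symm
  refine card_bij (fun s _ => d.attach.image fun l => s l.1 l.2) ?_ ?_ ?_
  · intro s hs
    have hgs : ∀ l (hl : l ∈ d), g (s l hl) = l := fun l hl => by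
      simpa using mem_pi.1 hs l hl
    have hinj : Function.Injective fun l : {l // l ∈ d} => s l.1 l.2 := by
      intro l l' h
      have := congrArg g h
      simp only [hgs] at this
      exact Subtype.ext this
    refine mem_filter.2 ⟨mem_powersetCard.2 ⟨subset_univ _, ?_⟩, ?_⟩
    · rw [card_image_of_injective _ hinj, card_attach]
    · rw [image_image]
      ext l
      simp [hgs]
  · intro s hs s' hs' h
    have hgs : ∀ l (hl : l ∈ d), g (s l hl) = l := fun l hl => by
      simpa using mem_pi.1 hs l hl
    have hgs' : ∀ l (hl : l ∈ d), g (s' l hl) = l := fun l hl => by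
      simpa using mem_pi.1 hs' l hl
    funext l hl
    have h1 : s l hl ∈ d.attach.image fun l => s l.1 l.2 :=
      mem_image.2 ⟨⟨l, hl⟩, mem_attach _ _, rfl⟩
    rw [h] at h1
    obtain ⟨⟨l', hl'⟩, _, h2⟩ := mem_image.1 h1
    have h3 := congrArg g h2
    simp only [hgs, hgs'] at h3
    subst h3
    exact h2.symm
  · intro e he
    obtain ⟨he1, he2⟩ := mem_filter.1 he
    have hcard := (mem_powersetCard.1 he1).2
    have hex : ∀ l ∈ d, ∃ x ∈ e, g x = l := fun l hl => by
      rw [← he2] at hl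
      simpa using hl
    choose s hse hsg using hex
    refine ⟨s, mem_pi.2 fun l hl => by simp [hsg], ?_⟩
    refine eq_of_subset_of_card_le ?_ ?_
    · intro x hx
      obtain ⟨l, _, rfl⟩ := mem_image.1 hx
      exact hse _ _
    · rw [hcard, card_image_of_injective, card_attach]
      intro l l' h
      have := congrArg g h
      simp only [hsg] at this
      exact Subtype.ext this

namespace UniformGraph

open Finset in
/-- The blow-up of the set system `E` along `g : V → L`: the edges are the `r`-sets of vertices
whose image under `g` belongs to `E`. -/
def blowUp (r : ℕ) {V L : Type*} [Fintype V] [DecidableEq V] [DecidableEq L]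
    (E : Finset (Finset L)) (g : V → L) : UniformGraph r V where
  edges := {e ∈ powersetCard r (univ : Finset V) | e.image g ∈ E}
  uniform := fun _ he => (mem_powersetCard.1 (mem_filter.1 he).1).2

open Finset in
theorem card_edges_blowUp {r : ℕ} {V L : Type*} [Fintype V] [DecidableEq V] [DecidableEq L]
    (E : Finset (Finset L)) (hE : ∀ d ∈ E, #d = r) (g : V → L) :
    #(blowUp r E g).edges = ∑ d ∈ E, ∏ l ∈ d, #{x | g x = l} := by
  have hmaps : ∀ e ∈ (blowUp r E g).edges, e.image g ∈ E := fun e he => (mem_filter.1 he).2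
  rw [card_eq_sum_card_fiberwise hmaps]
  refine sum_congr rfl fun d hd => ?_
  rw [← card_filter_image_eq, hE d hd]
  congr 1
  ext e
  simp only [blowUp, mem_filter]
  constructor
  · tauto
  · rintro ⟨h1, h2⟩
    exact ⟨⟨h1, h2 ▸ hd⟩, h2⟩

open Finset in
/-- A copy in a blow-up has at most as many edges as the edge polynomial evaluated at the numbers
of its vertices in the fibres. -/
theorem card_edges_le_of_blowUp_containsCopy {r : ℕ} {V W L : Type*} [Fintype V] [DecidableEq V]
    [Fintype W] [DecidableEq L] (E : Finset (Finset L))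
    (hE : ∀ d ∈ E, #d = r) (g : V → L) (H : UniformGraph r W) (h : (blowUp r E g).ContainsCopy H) :
    ∃ w : W → L, #H.edges ≤ ∑ d ∈ E, ∏ l ∈ d, #{x | w x = l} := by
  classical
  obtain ⟨f, hf⟩ := h
  refine ⟨g ∘ f, ?_⟩
  rw [← card_edges_blowUp E hE]
  refine card_le_card fun e he => ?_
  have h1 := (mem_filter.1 (hf e he)).2
  refine mem_filter.2 ⟨mem_powersetCard.2 ⟨subset_univ _, H.uniform e he⟩, ?_⟩
  rwa [map_eq_image, image_image] at h1

end UniformGraph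

/-! ### The pattern 3-graph and its edge polynomial. -/

open Finset in
theorem sum_powersetCard_two_prod {ι : Type*} [DecidableEq ι] (s : Finset ι) (w : ι → ℝ) :
    ∑ p ∈ powersetCard 2 s, ∏ i ∈ p, w i = ((∑ i ∈ s, w i) ^ 2 - ∑ i ∈ s, w i ^ 2) / 2 := by
  induction s using Finset.induction_on with
  | empty => rw [powersetCard_eq_empty.2 (by simp)]; simp
  | insert x s hx ih =>
    rw [powersetCard_succ_insert hx, sum_union, ih, sum_image, sum_insert hx, sum_insert hx]
    · have : ∑ p ∈ powersetCard 1 s, ∏ i ∈ insert x p, w i = w x * ∑ i ∈ s, w i := by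
        rw [powersetCard_one, sum_map, mul_sum]
        refine sum_congr rfl fun i hi => ?_
        have : x ≠ i := fun h => hx (h ▸ hi)
        simp [prod_pair this]
      rw [this]
      ring
    · intro p hp q hq h
      have hp' : x ∉ p := fun h => hx ((mem_powersetCard.1 hp).1 h)
      have hq' : x ∉ q := fun h => hx ((mem_powersetCard.1 hq).1 h)
      rw [← erase_insert hp', ← erase_insert hq', h]
    · rw [disjoint_left]
      intro p hp hp'
      obtain ⟨q, _, rfl⟩ := mem_image.1 hp'
      exact hx ((mem_powersetCard.1 hp).1 (mem_insert_self _ _))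

open Finset in
theorem disjSum_disjSum_injective {A B C : Type*} : Function.Injective
    (fun x : Finset A × Finset B × Finset C => x.1.disjSum (x.2.1.disjSum x.2.2)) := by
  intro x y h
  obtain ⟨h1, h2⟩ := disjSum_inj.1 h
  obtain ⟨h3, h4⟩ := disjSum_inj.1 h2
  exact Prod.ext h1 (Prod.ext h3 h4)

open Finset in
/-- The sets with an `A`-part, `B`-part and `C`-part taken from the families `P`, `Q`, `R`. -/
def joinFamilies {A B C : Type*} (P : Finset (Finset A)) (Q : Finset (Finset B))
    (R : Finset (Finset C)) : Finset (Finset (A ⊕ B ⊕ C)) :=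
  (P ×ˢ Q ×ˢ R).map ⟨_, disjSum_disjSum_injective⟩

open Finset in
theorem mem_joinFamilies {A B C : Type*} {P : Finset (Finset A)} {Q : Finset (Finset B)}
    {R : Finset (Finset C)} {e : Finset (A ⊕ B ⊕ C)} :
    e ∈ joinFamilies P Q R ↔
      ∃ s ∈ P, ∃ u ∈ Q, ∃ v ∈ R, s.disjSum (u.disjSum v) = e := by
  simp only [joinFamilies, mem_map, mem_product, Prod.exists]
  constructor
  · rintro ⟨s, u, v, ⟨hs, hu, hv⟩, h⟩
    exact ⟨s, hs, u, hu, v, hv, h⟩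
  · rintro ⟨s, hs, u, hu, v, hv, h⟩
    exact ⟨s, u, v, ⟨hs, hu, hv⟩, h⟩

open Finset in
theorem sum_joinFamilies {A B C : Type*} (P : Finset (Finset A))
    (Q : Finset (Finset B)) (R : Finset (Finset C)) (w : A ⊕ B ⊕ C → ℝ) :
    ∑ e ∈ joinFamilies P Q R, ∏ l ∈ e, w l =
      (∑ s ∈ P, ∏ i ∈ s, w (.inl i)) * ((∑ u ∈ Q, ∏ i ∈ u, w (.inr (.inl i))) *
        ∑ v ∈ R, ∏ i ∈ v, w (.inr (.inr i))) := by
  rw [joinFamilies, sum_map, sum_product, sum_mul]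
  refine sum_congr rfl fun s _ => ?_
  rw [sum_product, sum_mul_sum, mul_sum]
  refine sum_congr rfl fun u _ => ?_
  rw [mul_sum]
  refine sum_congr rfl fun v _ => ?_
  simp only [Function.Embedding.coeFn_mk, prod_disjSum]

-- The A-part alone separates the four edge types: it has 1, 2, 0 or 3 elements.
open Finset in
theorem disjoint_joinFamilies_left {A B C : Type*} [DecidableEq A] [DecidableEq B] [DecidableEq C]
    {P P' : Finset (Finset A)} {Q Q' : Finset (Finset B)} {R R' : Finset (Finset C)}
    (h : Disjoint P P') : Disjoint (joinFamilies P Q R) (joinFamilies P' Q' R') := by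
  rw [disjoint_left]
  intro e he he'
  obtain ⟨s, hs, u, hu, v, hv, rfl⟩ := mem_joinFamilies.1 he
  obtain ⟨s', hs', u', hu', v', hv', h'⟩ := mem_joinFamilies.1 he'
  obtain ⟨rfl, -⟩ := disjSum_inj.1 h'
  exact disjoint_left.1 h hs hs'

open Finset in
/-- The 3-graph with edges of the types `ABC`, `AAB`, `BBC` and the edges of `M` inside `A`. -/
def patternEdges {A B C : Type*} [Fintype A] [Fintype B] [Fintype C] [DecidableEq A]
    [DecidableEq B] [DecidableEq C] (M : Finset (Finset A)) : Finset (Finset (A ⊕ B ⊕ C)) :=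
  joinFamilies (powersetCard 1 univ) (powersetCard 1 univ) (powersetCard 1 univ) ∪
    (joinFamilies (powersetCard 2 univ) (powersetCard 1 univ) {∅} ∪
      (joinFamilies {∅} (powersetCard 2 univ) (powersetCard 1 univ) ∪ joinFamilies M {∅} {∅}))

open Finset in
theorem card_of_mem_patternEdges {A B C : Type*} [Fintype A] [Fintype B] [Fintype C]
    [DecidableEq A] [DecidableEq B] [DecidableEq C] (M : Finset (Finset A)) (hM : ∀ e ∈ M, #e = 3)
    (e : Finset (A ⊕ B ⊕ C)) (he : e ∈ patternEdges M) :
    #e = 3 := by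
  simp only [patternEdges, mem_union, mem_joinFamilies, mem_powersetCard, mem_singleton] at he
  rcases he with h | h | h | h <;> obtain ⟨s, hs, u, hu, v, hv, rfl⟩ := h <;>
    simp_all [card_disjSum]

open Finset in
/-- The edge polynomial of `patternEdges M`. -/
theorem sum_patternEdges {A B C : Type*} [Fintype A] [Fintype B] [Fintype C]
    [DecidableEq A] [DecidableEq B] [DecidableEq C] (M : Finset (Finset A)) (hM : ∀ e ∈ M, #e = 3)
    (w : A ⊕ B ⊕ C → ℝ) :
    ∑ e ∈ patternEdges M, ∏ l ∈ e, w l =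
      (∑ i, w (.inl i)) * ((∑ i, w (.inr (.inl i))) * ∑ i, w (.inr (.inr i))) +
      (((∑ i, w (.inl i)) ^ 2 - ∑ i, w (.inl i) ^ 2) / 2 * (∑ i, w (.inr (.inl i))) +
      (((∑ i, w (.inr (.inl i))) ^ 2 - ∑ i, w (.inr (.inl i)) ^ 2) / 2 * (∑ i, w (.inr (.inr i)))
      + ∑ e ∈ M, ∏ i ∈ e, w (.inl i))) := by
  have hd : ∀ k j : ℕ, k ≠ j → Disjoint (powersetCard k (univ : Finset A)) (powersetCard j univ) :=
    fun k j h => pairwise_disjoint_powersetCard _ h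
  have h0 : ({∅} : Finset (Finset A)) = powersetCard 0 univ := by simp
  have hMsub : M ⊆ powersetCard 3 univ := fun e he =>
    mem_powersetCard.2 ⟨subset_univ _, hM e he⟩
  have hdM : ∀ k : ℕ, k ≠ 3 → Disjoint (powersetCard k (univ : Finset A)) M :=
    fun k h => disjoint_of_subset_right hMsub (hd k 3 h)
  rw [patternEdges, sum_union, sum_union, sum_union]
  · simp only [sum_joinFamilies, powersetCard_one, sum_map, sum_powersetCard_two_prod]
    simp
  · rw [h0]; exact disjoint_joinFamilies_left (hdM 0 (by norm_num))
  · rw [disjoint_union_right, h0]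
    exact ⟨disjoint_joinFamilies_left (hd 2 0 (by norm_num)),
      disjoint_joinFamilies_left (hdM 2 (by norm_num))⟩
  · rw [disjoint_union_right, disjoint_union_right, h0]
    exact ⟨disjoint_joinFamilies_left (hd 1 2 (by norm_num)),
      disjoint_joinFamilies_left (hd 1 0 (by norm_num)),
      disjoint_joinFamilies_left (hdM 1 (by norm_num))⟩

/-! ### Existence and monotonicity of Turán densities. -/

section turanNumber

open Finset

variable {r : ℕ}

theorem bddAbove_card_edges (n : ℕ) (F : UniformFamily r) :
    BddAbove {k : ℕ | ∃ G : UniformGraph r (Fin n), G.IsFree F ∧ #G.edges = k} := by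
  refine ⟨n.choose r, ?_⟩
  rintro k ⟨G, _, rfl⟩
  calc #G.edges ≤ #(powersetCard r (univ : Finset (Fin n))) :=
        card_le_card fun e he => mem_powersetCard.2 ⟨subset_univ _, G.uniform e he⟩
    _ = n.choose r := by rw [card_powersetCard, card_univ, Fintype.card_fin]

theorem UniformGraph.IsFree.card_edges_le {n : ℕ} {F : UniformFamily r}
    {G : UniformGraph r (Fin n)} (hG : G.IsFree F) : #G.edges ≤ turanNumber n F :=
  le_csSup (bddAbove_card_edges n F) ⟨G, hG, rfl⟩

theorem turanNumber_le {n b : ℕ} {F : UniformFamily r}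
    (h : ∀ G : UniformGraph r (Fin n), G.IsFree F → #G.edges ≤ b) : turanNumber n F ≤ b := by
  rw [turanNumber]
  rcases Set.eq_empty_or_nonempty
    {k : ℕ | ∃ G : UniformGraph r (Fin n), G.IsFree F ∧ #G.edges = k} with he | hne
  · rw [he]
    simp
  · refine csSup_le hne ?_
    rintro k ⟨G, hG, rfl⟩
    exact h G hG

/-- The subgraph of `G` obtained by deleting the vertex `v`. -/
def UniformGraph.deleteVertex {n : ℕ} (G : UniformGraph r (Fin (n + 1))) (v : Fin (n + 1)) :
    UniformGraph r (Fin n) where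
  edges := {e | e.map v.succAboveEmb ∈ G.edges}
  uniform := fun e he => by
    rw [← G.uniform _ (mem_filter.1 he).2, card_map]

theorem UniformGraph.IsFree.deleteVertex {n : ℕ} {F : UniformFamily r}
    {G : UniformGraph r (Fin (n + 1))} (hG : G.IsFree F) (v : Fin (n + 1)) :
    (G.deleteVertex v).IsFree F := by
  rintro H hH ⟨f, hf⟩
  refine hG H hH ⟨f.trans v.succAboveEmb, fun e he => ?_⟩
  rw [← map_map]
  exact (mem_filter.1 (hf e he)).2

theorem UniformGraph.card_edges_deleteVertex {n : ℕ} (G : UniformGraph r (Fin (n + 1)))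
    (v : Fin (n + 1)) : #(G.deleteVertex v).edges = #{e ∈ G.edges | v ∉ e} := by
  rw [← card_map (mapEmbedding v.succAboveEmb).toEmbedding]
  congr 1
  ext e
  simp only [UniformGraph.deleteVertex, mem_map, mem_filter, mem_univ, true_and]
  constructor
  · rintro ⟨e, he, rfl⟩
    refine ⟨he, ?_⟩
    simp [mapEmbedding_apply, Fin.succAbove_ne]
  · rintro ⟨he, hv⟩
    have hsub : (e : Set (Fin (n + 1))) ⊆ Set.range v.succAboveEmb := by
      intro x hx
      have hx' : x ≠ v := fun h => hv (h ▸ hx)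
      obtain ⟨y, rfl⟩ := Fin.exists_succAbove_eq hx'
      exact ⟨y, rfl⟩
    obtain ⟨e', rfl⟩ : ∃ e' : Finset (Fin n), e'.map v.succAboveEmb = e := by
      refine ⟨e.preimage v.succAboveEmb v.succAboveEmb.injective.injOn, ?_⟩
      rw [map_eq_image, image_preimage_of_bij]
      exact ⟨fun x hx => by simpa using hx, v.succAboveEmb.injective.injOn, by
        intro x hx
        obtain ⟨y, rfl⟩ := hsub hx
        exact ⟨y, by simpa using hx, rfl⟩⟩
    exact ⟨e', he, rfl⟩

/-- Averaging over the vertex-deleted subgraphs. -/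
theorem turanNumber_succ_mul_le (n : ℕ) (F : UniformFamily r) :
    turanNumber (n + 1) F * (n + 1 - r) ≤ (n + 1) * turanNumber n F := by
  rcases Nat.eq_zero_or_pos (n + 1 - r) with h0 | h0
  · simp [h0]
  rw [← Nat.le_div_iff_mul_le h0]
  refine turanNumber_le fun G hG => ?_
  rw [Nat.le_div_iff_mul_le h0]
  -- Double counting: each edge survives the deletion of the `n + 1 - r` vertices outside it.
  have h1 : ∑ v, #(G.deleteVertex v).edges = #G.edges * (n + 1 - r) := by
    simp only [UniformGraph.card_edges_deleteVertex]
    simp only [card_filter]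
    rw [sum_comm, ← smul_eq_mul, ← sum_const]
    refine sum_congr rfl fun e he => ?_
    rw [← card_filter, filter_not, filter_mem_eq_inter, univ_inter,
      card_sdiff_of_subset (subset_univ _), card_univ, Fintype.card_fin, G.uniform e he]
  rw [← h1]
  calc ∑ v, #(G.deleteVertex v).edges ≤ ∑ _v : Fin (n + 1), turanNumber n F :=
        sum_le_sum fun v _ => (hG.deleteVertex v).card_edges_le
    _ = _ := by simp

/-- The Katona–Nemetz–Simonovits monotonicity of the Turán densities `ex(n, F) / (n choose r)`. -/
theorem antitone_turanNumber_div_choose (F : UniformFamily r) :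
    Antitone fun n : ℕ => (turanNumber (n + r) F : ℝ) / ((n + r).choose r : ℝ) := by
  refine antitone_nat_of_succ_le fun n => ?_
  have h1 : (0 : ℝ) < (n + r).choose r := by exact_mod_cast Nat.choose_pos (by omega)
  have h2 : (0 : ℝ) < (n + 1 + r).choose r := by exact_mod_cast Nat.choose_pos (by omega)
  rw [div_le_div_iff₀ h2 h1]
  have h3 := turanNumber_succ_mul_le (n + r) F
  have h4 := Nat.choose_mul_succ_eq (n + r) r
  have h5 : n + r + 1 - r = n + 1 := by omega
  have h6 : n + 1 + r = n + r + 1 := by omega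
  rw [h6]
  rw [h5] at h3 h4
  have h3 : (turanNumber (n + r + 1) F : ℝ) * (n + 1) ≤ (n + r + 1) * turanNumber (n + r) F := by
    exact_mod_cast h3
  have h4 : ((n + r).choose r : ℝ) * (n + r + 1) = (n + r + 1).choose r * (n + 1) := by
    exact_mod_cast h4
  have h7 : (0 : ℝ) < n + 1 := by positivity
  refine le_of_mul_le_mul_right ?_ h7
  calc (turanNumber (n + r + 1) F : ℝ) * (n + r).choose r * (n + 1)
      = (turanNumber (n + r + 1) F : ℝ) * (n + 1) * (n + r).choose r := by ring
    _ ≤ (n + r + 1) * turanNumber (n + r) F * (n + r).choose r := by gcongr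
    _ = turanNumber (n + r) F * ((n + r).choose r * (n + r + 1)) := by ring
    _ = turanNumber (n + r) F * (n + r + 1).choose r * (n + 1) := by rw [h4]; ring

/-- The Turán density exists, and it is at most every `ex(m, F) / (m choose r)` with `r ≤ m`. -/
theorem exists_hasTuranDensity (F : UniformFamily r) :
    ∃ d, HasTuranDensity F d ∧
      ∀ m, r ≤ m → d ≤ (turanNumber m F : ℝ) / (m.choose r : ℝ) := by
  have hanti := antitone_turanNumber_div_choose F
  have hbdd : BddBelow (Set.range fun n : ℕ =>
      (turanNumber (n + r) F : ℝ) / ((n + r).choose r : ℝ)) :=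
    ⟨0, by rintro _ ⟨n, rfl⟩; positivity⟩
  refine ⟨_, (Filter.tendsto_add_atTop_iff_nat r).1 (tendsto_atTop_ciInf hanti hbdd), ?_⟩
  intro m hm
  have := ciInf_le hbdd (m - r)
  simpa only [Nat.sub_add_cancel hm] using this

end turanNumber

/-! ### The construction and the conclusion. -/

open Finset in
/-- Copies in a blow-up of `patternEdges M` with `M` locally sparse have at most
`(2 / 25) m ^ 3` edges. -/
theorem card_edges_le_of_blowUp_patternEdges {A B C V : Type*} [Fintype A] [Fintype B] [Fintype C]
    [Fintype V] [DecidableEq V] [DecidableEq A] [DecidableEq B] [DecidableEq C]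
    (M : Finset (Finset A)) (hM3 : ∀ e ∈ M, #e = 3) (m : ℕ)
    (hM : ∀ S : Finset A, 2 ≤ #S → #S ≤ m → #{e ∈ M | e ⊆ S} + 2 ≤ #S)
    (g : V → A ⊕ B ⊕ C) (H : UniformGraph 3 (Fin m))
    (h : (UniformGraph.blowUp 3 (patternEdges M) g).ContainsCopy H) :
    (#H.edges : ℝ) ≤ 2 / 25 * (m : ℝ) ^ 3 := by
  obtain ⟨f, hf⟩ := UniformGraph.card_edges_le_of_blowUp_containsCopy _
    (card_of_mem_patternEdges M hM3) g H h
  set w : A ⊕ B ⊕ C → ℝ := fun l => (#{x | f x = l} : ℝ) with hw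
  have hf' : (#H.edges : ℝ) ≤ ∑ d ∈ patternEdges M, ∏ l ∈ d, w l := by
    simp only [hw]
    exact_mod_cast hf
  rw [sum_patternEdges M hM3] at hf'
  have hw0 : ∀ l, 0 ≤ w l := fun l => Nat.cast_nonneg _
  have hsum : ∑ i, w (.inl i) + ∑ i, w (.inr (.inl i)) + ∑ i, w (.inr (.inr i)) = m := by
    have h1 : ∑ l, w l = m := by
      have := card_eq_sum_card_fiberwise (f := f) (s := univ) (t := univ) (fun x _ => mem_univ _)
      rw [card_univ, Fintype.card_fin] at this
      simp only [hw]
      exact_mod_cast this.symm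
    rw [← h1, Fintype.sum_sum_type, Fintype.sum_sum_type, add_assoc]
  -- Only `m` vertices are placed, so at most `m` labels carry weight; sparsity of `M` up to size
  -- `m` is enough.
  have hsupp : #{i | w (.inl i) ≠ 0} ≤ m := by
    have h1 : ({i | w (.inl i) ≠ 0} : Finset A).map ⟨Sum.inl, Sum.inl_injective⟩ ⊆
        univ.image f := by
      intro l hl
      obtain ⟨i, hi, rfl⟩ := mem_map.1 hl
      have hi := (mem_filter.1 hi).2
      simp only [hw, ne_eq, Nat.cast_eq_zero, card_eq_zero] at hi
      obtain ⟨x, hx⟩ := nonempty_iff_ne_empty.2 hi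
      exact mem_image.2 ⟨x, mem_univ _, (mem_filter.1 hx).2⟩
    calc _ = _ := (card_map _).symm
      _ ≤ #(univ.image f) := card_le_card h1
      _ ≤ #(univ : Finset (Fin m)) := card_image_le
      _ = m := by simp
  have ha : 0 ≤ ∑ i, w (.inl i) := sum_nonneg fun i _ => hw0 _
  have hb : 0 ≤ ∑ i, w (.inr (.inl i)) := sum_nonneg fun i _ => hw0 _
  have hc : 0 ≤ ∑ i, w (.inr (.inr i)) := sum_nonneg fun i _ => hw0 _
  have hb2 : 0 ≤ ∑ i, w (.inr (.inl i)) ^ 2 := sum_nonneg fun i _ => sq_nonneg _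
  have hsp := sparse_edge_polynomial_le_sum_sq M hM3 m hM (fun i => w (.inl i)) (fun i => hw0 _)
    hsupp hb
  have hpat := pattern_polynomial_le ha hb hc
  rw [hsum] at hpat
  -- The square sums over A cancel; the negative one over B is discarded.
  nlinarith [mul_nonneg hb2 hc]

-- The loss 3q² is 2q² from AAB and q² from BBC.
open Finset in
theorem card_patternEdges {q : ℕ} (M : Finset (Finset (Fin (2 * q)))) (hM3 : ∀ e ∈ M, #e = 3) :
    (#(patternEdges (B := Fin (2 * q)) (C := Fin q) M) : ℝ) = 10 * q ^ 3 - 3 * q ^ 2 + #M := by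
  have := sum_patternEdges (B := Fin (2 * q)) (C := Fin q) M hM3 (fun _ => 1)
  simp only [prod_const_one, sum_const, card_univ, Fintype.card_fin, nsmul_eq_mul, mul_one,
    one_pow, Nat.cast_mul, Nat.cast_ofNat] at this
  rw [this]
  ring

open Finset in
/-- There are arbitrarily large 3-graphs of density bounded away from `12 / 25` from above, all of
whose `m`-vertex subgraphs have density less than `12 / 25 + c`. -/
theorem exists_dense_with_sparse_subgraphs {c : ℝ} (hc : 0 < c) :
    ∃ m : ℕ, 3 ≤ m ∧ ∃ ε : ℝ, 0 < ε ∧ ∀ n₀ : ℕ, ∃ n, n₀ < n ∧ ∃ G : UniformGraph 3 (Fin n),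
      12 / 25 + ε ≤ G.density ∧
        ∀ H : UniformGraph 3 (Fin m), G.ContainsCopy H → H.density < 12 / 25 + c := by
  have hchoose : ∀ n : ℕ, (n.choose 3 : ℝ) = n * (n - 1) * (n - 2) / 6 := fun n => by
    rw [Nat.cast_choose_eq_descPochhammer_div]
    simp [descPochhammer_succ_right, Nat.factorial]
  obtain ⟨m, hm⟩ := exists_nat_ge (6 + 3 / c)
  have hc3 : 0 < 3 / c := by positivity
  have hm6 : (6 : ℝ) ≤ m := by linarith
  have hmc : 3 ≤ c * m := by
    have : 3 / c ≤ m := by linarith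
    rw [div_le_iff₀ hc] at this
    linarith
  obtain ⟨t₀, ht₀⟩ := exists_locally_sparse m
  set q := t₀ + 1 with hq
  have hq0 : (0 : ℝ) < q := by rw [hq]; positivity
  obtain ⟨M, hM3, hMcard, hM⟩ := ht₀ (2 * q) (by omega)
  -- The net gain of q² in 10q³ + q² edges on 5q labels is 6/(125q) in density, whatever the blow-up
  -- factor `k`.
  refine ⟨m, by exact_mod_cast (show (3 : ℝ) ≤ m by linarith), 6 / (125 * q), by positivity,
    fun n₀ => ?_⟩
  set k := n₀ + 1 with hk
  have hk0 : (0 : ℝ) < k := by rw [hk]; positivity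
  have hcard : Fintype.card ((Fin (2 * q) ⊕ Fin (2 * q) ⊕ Fin q) × Fin k) = 5 * q * k := by
    simp only [Fintype.card_prod, Fintype.card_sum, Fintype.card_fin]
    ring
  let φ := (Fintype.equivFinOfCardEq hcard).symm
  let g : Fin (5 * q * k) → Fin (2 * q) ⊕ Fin (2 * q) ⊕ Fin q := fun x => (φ x).1
  have hfib : ∀ l, #{x | g x = l} = k := by
    intro l
    have h1 : ({x | g x = l} : Finset _) =
        (univ : Finset (Fin k)).image fun j => φ.symm (l, j) := by
      ext x
      simp only [g, mem_filter, mem_univ, true_and, mem_image, Equiv.symm_apply_eq]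
      constructor
      · rintro rfl
        exact ⟨(φ x).2, rfl⟩
      · rintro ⟨j, hj⟩
        rw [← hj]
    rw [h1, card_image_of_injective _ fun j j' h => by simpa using h, card_univ, Fintype.card_fin]
  refine ⟨5 * q * k, by nlinarith, UniformGraph.blowUp 3 (patternEdges M) g, ?_, fun H hH => ?_⟩
  · have hE : (#(UniformGraph.blowUp 3 (patternEdges M) g).edges : ℝ) =
        (10 * q ^ 3 - 3 * q ^ 2 + #M) * k ^ 3 := by
      rw [UniformGraph.card_edges_blowUp _ (card_of_mem_patternEdges M hM3),
        ← card_patternEdges M hM3, sum_congr rfl (g := fun _ => k ^ 3)]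
      · simp
      · intro d hd
        rw [prod_congr rfl fun l _ => hfib l, prod_const, card_of_mem_patternEdges M hM3 d hd]
    have hMcard : 4 * (q : ℝ) ^ 2 ≤ #M := by
      have : ((2 * q) ^ 2 : ℝ) ≤ #M := by exact_mod_cast hMcard
      linarith
    have hn : (5 : ℝ) ≤ 5 * q * k := by
      have h1 : (1 : ℝ) ≤ q := by rw [hq]; push_cast; linarith [Nat.cast_nonneg (α := ℝ) t₀]
      have h2 : (1 : ℝ) ≤ k := by rw [hk]; push_cast; linarith [Nat.cast_nonneg (α := ℝ) n₀]
      nlinarith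
    rw [UniformGraph.density, hE, Fintype.card_fin, hchoose]
    push_cast
    set n : ℝ := 5 * q * k with hn'
    have hpos : 0 < n * (n - 1) * (n - 2) / 6 := by
      have := mul_pos (mul_pos (show 0 < n by linarith) (show 0 < n - 1 by linarith))
        (show 0 < n - 2 by linarith)
      linarith
    have hle : n * (n - 1) * (n - 2) / 6 ≤ n ^ 3 / 6 := by nlinarith
    rw [le_div_iff₀ hpos]
    calc (12 / 25 + 6 / (125 * (q : ℝ))) * (n * (n - 1) * (n - 2) / 6)
        ≤ (12 / 25 + 6 / (125 * (q : ℝ))) * (n ^ 3 / 6) := by gcongr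
      _ = (10 * q ^ 3 + q ^ 2) * k ^ 3 := by rw [hn']; field_simp; ring
      _ ≤ _ := mul_le_mul_of_nonneg_right (by linarith) (by positivity)
  · have hH := card_edges_le_of_blowUp_patternEdges M hM3 m hM g H hH
    rw [UniformGraph.density, Fintype.card_fin, hchoose]
    have hpos : 0 < (m : ℝ) * (m - 1) * (m - 2) / 6 := by
      have := mul_pos (mul_pos (show (0 : ℝ) < m by linarith) (show (0 : ℝ) < m - 1 by linarith))
        (show (0 : ℝ) < m - 2 by linarith)
      linarith
    rw [div_lt_iff₀ hpos]
    refine hH.trans_lt ?_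
    -- the claim is `12 / 25 * (3 * m - 2) < c * (m - 1) * (m - 2)`
    have h1 : 3 * ((m : ℝ) / 2) ≤ c * ((m - 1) * (m - 2)) := by
      calc 3 * ((m : ℝ) / 2) ≤ c * m * (m / 2) := by gcongr
        _ = c * (m * (m / 2)) := by ring
        _ ≤ c * ((m - 1) * (m - 2)) := mul_le_mul_of_nonneg_left (by nlinarith) hc.le
    have h2 : 12 / 25 * (3 * (m : ℝ) - 2) < c * ((m - 1) * (m - 2)) := by linarith
    have h3 := mul_lt_mul_of_pos_left h2 (show (0 : ℝ) < m / 6 by linarith)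
    nlinarith

theorem theorem1p1 :
    ¬ IsJump 3 (12 / 25 : ℝ) ∧
      ∀ c : ℝ, 0 < c → (turanDensities 3 ∩ Set.Ioo (12 / 25 : ℝ) (12 / 25 + c)).Nonempty := by
  refine ⟨?_, fun c hc => ?_⟩
  · rintro ⟨c, hc, hjump⟩
    obtain ⟨m, hm, ε, hε, hG⟩ := exists_dense_with_sparse_subgraphs hc
    obtain ⟨n₀, hn₀⟩ := hjump ε hε m hm
    obtain ⟨n, hn, G, hGd, hGs⟩ := hG n₀
    obtain ⟨H, hH, hHd⟩ := hn₀ n hn G hGd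
    exact absurd hHd (not_le.2 (hGs H hH))
  -- Halving `c` makes the upper bound on the Turán density strict.
  · obtain ⟨m, hm, ε, hε, hG⟩ := exists_dense_with_sparse_subgraphs (half_pos hc)
    let F : UniformFamily 3 :=
      {K | ∃ H : UniformGraph 3 (Fin m), 12 / 25 + c / 2 ≤ H.density ∧ K = ⟨m, H⟩}
    obtain ⟨d, hd, hdle⟩ := exists_hasTuranDensity F
    have hchoose : ∀ n : ℕ, 3 ≤ n → (0 : ℝ) < n.choose 3 := fun n hn => by
      exact_mod_cast Nat.choose_pos hn
    refine ⟨d, ⟨F, hd⟩, ?_, ?_⟩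
    · have hlow : 12 / 25 + ε ≤ d := by
        -- The limit is known to exist, so `F`-free graphs at infinitely many orders suffice.
        refine ge_of_tendsto_of_frequently hd ?_
        rw [Filter.frequently_atTop']
        intro n₀
        obtain ⟨n, hn, G, hGd, hGs⟩ := hG n₀
        refine ⟨n, hn, hGd.trans ?_⟩
        have hfree : G.IsFree F := by
          rintro _ ⟨H, hHd, rfl⟩ hH
          exact absurd hHd (not_le.2 (hGs H hH))
        rw [UniformGraph.density, Fintype.card_fin]
        gcongr
        exact hfree.card_edges_le
      linarith
    · have hup : (turanNumber m F : ℝ) ≤ (12 / 25 + c / 2) * m.choose 3 := by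
        have hpos : 0 ≤ (12 / 25 + c / 2) * (m.choose 3 : ℝ) := by positivity
        refine (Nat.cast_le.2 (turanNumber_le fun G hG => ?_)).trans (Nat.floor_le hpos)
        refine Nat.le_floor ?_
        by_contra! hlt
        -- On exactly `m` vertices, a graph this dense is itself a member of `F`.
        refine hG ⟨m, G⟩ ⟨G, ?_, rfl⟩ ⟨Function.Embedding.refl _, fun e he => by simpa using he⟩
        rw [UniformGraph.density, Fintype.card_fin, le_div_iff₀ (hchoose m hm)]
        exact hlt.le
      have h1 := hdle m hm
      have h2 : (turanNumber m F : ℝ) / m.choose 3 ≤ 12 / 25 + c / 2 := by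
        rwa [div_le_iff₀ (hchoose m hm)]
      linarith
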